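/- For $f\in L^2(\mathbb R)$ (complex-valued) and $k\in\mathbb Z$ put $t_kf(x)=f(x-k)$, and let $\widehat f$ denote the $L^2$ Fourier transform with the normalization $\widehat f(\zeta)=\int_{\mathbb R} f(x)e^{-2\pi i x\zeta}\,dx$ for integrable $f$. A closed subspace $V\subset L^2(\mathbb R)$ is shift-invariant if $t_kf\in V$ for all $f\in V$, $k\in\mathbb Z$. A family $\{v_k\}_{k\in\mathbb Z}\subset V$ is a frame of $V$ if there are $a,b>0$ with $a\|f\|^2\le\sum_k|\langle f,v_k\rangle|^2\le b\|f\|^2$ for all $f\in V$; it is a Riesz basis of $V$ with lower and upper bounds $A,B>0$ if it is a frame of $V$ and $A\sum_k|c_k|^2\le\big\|\sum_kc_kv_k\big\|^2\le B\sum_k|c_k|^2$ for all finitely supported sequences $c=(c_k)_{k\in\mathbb Z}$ of complex numbers. Two families $\{v_k\}_{k\in\mathbb Z}$, $\{w_k\}_{k\in\mathbb Z}$ in $V$ are woven if for every $J\subset\mathbb Z$ the family $\{v_k\}_{k\in J}\cup\{w_k\}_{k\in\mathbb Z\setminus J}$ is a frame of $V$. Let $V\subset L^2(\mathbb R)$ be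 a shift-invariant space and let $\varphi\in V$ be such that $\{t_k\varphi\}_{k\in\mathbb Z}$ is a Riesz basis of $V$ with lower and upper bounds $A$ and $B$. Let $\psi\in V$ and suppose that there is a constant $\mu\ge 0$ with $\mu<A$ such that $$\sum_{k\in\mathbb Z}|\widehat\varphi(\zeta+k)-\widehat\psi(\zeta+k)|^2\le\mu\qquad\text{for a.e. }\zeta\in[-1/2,1/2).$$ Then $\{t_k\psi\}_{k\in\mathbb Z}$ is a Riesz basis of $V$, and $\{t_k\psi\}_{k\in\mathbb Z}$ and $\{t_k\varphi\}_{k\in\mathbb Z}$ are woven. -/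

import Mathlib

open MeasureTheory FourierTransform
open scoped NNReal ENNReal

/-- The Hilbert space `L²(ℝ)` of complex-valued functions. -/
abbrev L2R : Type := Lp (α := ℝ) ℂ 2

section Frames

variable {H : Type*} [NormedAddCommGroup H] [InnerProductSpace ℂ H] {ι : Type*}

/-- The family `v` is a frame of the subspace `V`: its members lie in `V`, and there are `a, b > 0`
with `a ‖f‖² ≤ ∑ i, |⟨f, v i⟩|² ≤ b ‖f‖²` for all `f ∈ V`. -/
def IsFrameOf (V : Submodule ℂ H) (v : ι → H) : Prop :=
  (∀ i, v i ∈ V) ∧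
    ∃ a b : ℝ, 0 < a ∧ 0 < b ∧ ∀ f ∈ V,
      Summable (fun i => ‖inner ℂ (v i) f‖ ^ 2) ∧
      a * ‖f‖ ^ 2 ≤ ∑' i, ‖inner ℂ (v i) f‖ ^ 2 ∧
      ∑' i, ‖inner ℂ (v i) f‖ ^ 2 ≤ b * ‖f‖ ^ 2

/-- The family `v` is a Riesz sequence with lower bound `A > 0` and upper bound `B > 0`:
`A ‖c‖² ≤ ‖∑ i, c i • v i‖² ≤ B ‖c‖²` in the `ℓ²` norm, for all finitely supported `c`. -/
def IsRieszSequenceWith (v : ι → H) (A B : ℝ) : Prop :=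
  0 < A ∧ 0 < B ∧ ∀ c : ι →₀ ℂ,
    A * (∑ i ∈ c.support, ‖c i‖ ^ 2) ≤ ‖∑ i ∈ c.support, c i • v i‖ ^ 2 ∧
    ‖∑ i ∈ c.support, c i • v i‖ ^ 2 ≤ B * (∑ i ∈ c.support, ‖c i‖ ^ 2)

/-- The family `v` is a Riesz basis of `V` with lower and upper Riesz bounds `A` and `B`:
it is a Riesz sequence with these bounds and a frame of `V`. -/
def IsRieszBasisWith (V : Submodule ℂ H) (v : ι → H) (A B : ℝ) : Prop :=
  IsRieszSequenceWith v A B ∧ IsFrameOf V v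

/-- The family `v` is a Riesz basis of `V`. -/
def IsRieszBasisOf (V : Submodule ℂ H) (v : ι → H) : Prop :=
  ∃ A B : ℝ, IsRieszBasisWith V v A B

open scoped Classical in
/-- The weaving of `v` and `w` along `J`: the members of `v` with index in `J` together with the
members of `w` with index outside `J`. -/
noncomputable def weaving (v w : ι → H) (J : Set ι) : ι → H :=
  fun i => if i ∈ J then v i else w i

/-- The families `v` and `w` are woven in `V`: each of their weavings is a frame of `V`
(the weavings along `Set.univ` and `∅` are `v` and `w` themselves). -/
def AreWovenIn (V : Submodule ℂ H) (v w : ι → H) : Prop :=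
  ∀ J : Set ι, IsFrameOf V (weaving v w J)

end Frames

/-- The shiftBy `t_k f = f (· - k)` of `f ∈ L²(ℝ)`. -/
noncomputable def shiftBy (k : ℤ) (f : L2R) : L2R :=
  Lp.compMeasurePreserving (fun x : ℝ => x - (k : ℝ))
    (measurePreserving_sub_right volume (k : ℝ)) f

/-- A shift-invariant space: a closed subspace of `L²(ℝ)` stable under integer translations. -/
structure IsShiftInvariantSpace (V : Submodule ℂ L2R) : Prop where
  isClosed : IsClosed (V : Set L2R)
  shiftBy_mem : ∀ (k : ℤ), ∀ f ∈ V, shiftBy k f ∈ V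

/-- `φ` is a Riesz generator of `V` with Riesz bounds `A` and `B`: its integer translates form a
Riesz basis of `V` with these bounds. -/
def IsRieszGeneratorWith (V : Submodule ℂ L2R) (φ : L2R) (A B : ℝ) : Prop :=
  IsRieszBasisWith V (fun k : ℤ => shiftBy k φ) A B

/-! ### Perturbation of Riesz bases in Hilbert space. -/

section PaleyWiener

variable {H : Type*} [NormedAddCommGroup H] [InnerProductSpace ℂ H] {ι : Type*}

/-! On the Fourier side `∑ c_k t_k g` becomes a 1-periodic trigonometric polynomial `P` times `𝓕 g`.
Folding the line onto one period gives `‖∑ c_k t_k g‖² = ∫ |P|² ∑_k |𝓕 g(ζ + k)|²`, so with `g = φ -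
ψ` and Parseval the hypothesis makes `μ` an upper Riesz bound of the differences `t_k φ - t_k ψ`
(`norm_sum_smul_shiftBy_sq_le`).

Since `μ < A`, such a perturbation cannot destroy the lower Riesz bound. Nor can it destroy the
lower frame bound: `A` is also a lower frame bound of the original basis, and `μ` a Bessel bound of
the differences (`IsRieszBasisWith.isRieszBasisOf_of_hasUpperRieszBound_sub`). A weaving differs
from the basis of translates of `φ` only off `J`, so the same `μ` works for every `J`. -/

theorem add_sq_le_mul_sq_add_mul_sq {t : ℝ} (ht : 0 < t) (x y : ℝ) :
    (x + y) ^ 2 ≤ (1 + t) * x ^ 2 + (1 + 1 / t) * y ^ 2 := by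
  have h : (1 + t) * x ^ 2 + (1 + 1 / t) * y ^ 2 - (x + y) ^ 2 = (t * x - y) ^ 2 / t := by
    field_simp
    ring
  have : 0 ≤ (t * x - y) ^ 2 / t := by positivity
  linarith

theorem norm_add_sq_le_mul_sq_add_mul_sq {E : Type*} [SeminormedAddCommGroup E] {t : ℝ}
    (ht : 0 < t) (x y : E) :
    ‖x + y‖ ^ 2 ≤ (1 + t) * ‖x‖ ^ 2 + (1 + 1 / t) * ‖y‖ ^ 2 :=
  (pow_le_pow_left₀ (norm_nonneg _) (norm_add_le x y) 2).trans
    (add_sq_le_mul_sq_add_mul_sq ht _ _)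

/-- `B` is an upper Riesz bound of the family `v`. -/
def HasUpperRieszBound (v : ι → H) (B : ℝ) : Prop :=
  ∀ (s : Finset ι) (c : ι → ℂ), ‖∑ i ∈ s, c i • v i‖ ^ 2 ≤ B * ∑ i ∈ s, ‖c i‖ ^ 2

/-- An upper Riesz bound is a Bessel bound. -/
theorem HasUpperRieszBound.sum_norm_inner_sq_le {v : ι → H} {B : ℝ}
    (hB : 0 ≤ B) (h : HasUpperRieszBound v B) (f : H) (s : Finset ι) :
    ∑ i ∈ s, ‖inner ℂ (v i) f‖ ^ 2 ≤ B * ‖f‖ ^ 2 := by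
  set S := ∑ i ∈ s, ‖inner ℂ (v i) f‖ ^ 2 with hS
  have hS0 : 0 ≤ S := by positivity
  -- Pairing `f` with the synthesis of its own coefficients returns `S`; Cauchy–Schwarz and the
  -- Riesz bound then give `S² ≤ B S ‖f‖²`.
  have h1 : inner ℂ (∑ i ∈ s, inner ℂ (v i) f • v i) f = (S : ℂ) := by
    rw [sum_inner, hS]
    push_cast
    refine Finset.sum_congr rfl fun i _ => ?_
    rw [inner_smul_left, Complex.conj_mul']
  have h2 : S ≤ ‖∑ i ∈ s, inner ℂ (v i) f • v i‖ * ‖f‖ := by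
    have := norm_inner_le_norm (𝕜 := ℂ) (∑ i ∈ s, inner ℂ (v i) f • v i) f
    rwa [h1, Complex.norm_real, Real.norm_of_nonneg hS0] at this
  have h3 := h s fun i => inner ℂ (v i) f
  rcases hS0.eq_or_lt with h0 | h0
  · rw [← h0]
    positivity
  · have h4 : S ^ 2 ≤ (B * S) * ‖f‖ ^ 2 := by
      calc S ^ 2 ≤ (‖∑ i ∈ s, inner ℂ (v i) f • v i‖ * ‖f‖) ^ 2 := by gcongr
        _ = ‖∑ i ∈ s, inner ℂ (v i) f • v i‖ ^ 2 * ‖f‖ ^ 2 := mul_pow _ _ _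
        _ ≤ _ := by gcongr
    nlinarith

theorem IsRieszSequenceWith.hasUpperRieszBound {v : ι → H} {A B : ℝ}
    (h : IsRieszSequenceWith v A B) : HasUpperRieszBound v B := by
  classical
  intro s c
  have h1 := (h.2.2 (Finsupp.onFinset s (fun i => if i ∈ s then c i else 0) (by simp_all))).2
  have e1 := Finsupp.onFinset_sum (f := fun i => if i ∈ s then c i else 0) (s := s)
    (by simp_all) (g := fun i z => z • v i) (by simp)
  have e2 := Finsupp.onFinset_sum (f := fun i => if i ∈ s then c i else 0) (s := s)
    (by simp_all) (g := fun _ z => ‖z‖ ^ 2) (by simp)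
  rw [Finsupp.sum] at e1 e2
  rw [e1, e2] at h1
  have e3 : ∑ i ∈ s, c i • v i = ∑ i ∈ s, (if i ∈ s then c i else 0) • v i :=
    Finset.sum_congr rfl fun i hi => by rw [if_pos hi]
  have e4 : ∑ i ∈ s, ‖c i‖ ^ 2 = ∑ i ∈ s, ‖if i ∈ s then c i else 0‖ ^ 2 :=
    Finset.sum_congr rfl fun i hi => by rw [if_pos hi]
  rwa [e3, e4]

/-- In a closed subspace the members of a frame span a dense subspace. -/
theorem IsFrameOf.mem_topologicalClosure_span [CompleteSpace H] {V : Submodule ℂ H}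
    (hV : IsClosed (V : Set H)) {v : ι → H} (h : IsFrameOf V v) {f : H} (hf : f ∈ V) :
    f ∈ (Submodule.span ℂ (Set.range v)).topologicalClosure := by
  obtain ⟨hmem, a, b, ha, -, hab⟩ := h
  set W := (Submodule.span ℂ (Set.range v)).topologicalClosure with hW
  have hWV : W ≤ V :=
    Submodule.topologicalClosure_minimal _ (Submodule.span_le.2 (Set.range_subset_iff.2 hmem)) hV
  have : CompleteSpace W :=
    (Submodule.isClosed_topologicalClosure (Submodule.span ℂ (Set.range v))).completeSpace_coe
  -- The residual stays in `V` because `W ≤ V`, so the lower frame inequality applies to it and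
  -- forces it to vanish.
  set g := f - W.starProjection f with hg
  have hgV : g ∈ V := V.sub_mem hf (hWV (W.starProjection_apply_mem f))
  have horth : ∀ i, inner ℂ (v i) g = 0 := fun i =>
    Submodule.inner_right_of_mem_orthogonal
      (Submodule.le_topologicalClosure _ (Submodule.subset_span (Set.mem_range_self i)))
      (W.sub_starProjection_mem_orthogonal f)
  have h1 := (hab g hgV).2.1
  simp only [horth, norm_zero, ne_eq, OfNat.ofNat_ne_zero, not_false_eq_true, zero_pow,
    tsum_zero] at h1
  have h2 : g = 0 := by
    by_contra hne
    have : 0 < a * ‖g‖ ^ 2 := by positivity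
    linarith
  rw [sub_eq_zero.1 h2]
  exact W.starProjection_apply_mem f

/-- The lower Riesz bound of a Riesz basis is a lower frame bound. -/
theorem IsRieszBasisWith.mul_norm_sq_le_tsum [CompleteSpace H] {V : Submodule ℂ H}
    (hV : IsClosed (V : Set H)) {v : ι → H} {A B : ℝ} (h : IsRieszBasisWith V v A B) {f : H}
    (hf : f ∈ V) : A * ‖f‖ ^ 2 ≤ ∑' i, ‖inner ℂ (v i) f‖ ^ 2 := by
  obtain ⟨⟨hA, -, hR⟩, hF⟩ := h
  have hcl := hF.mem_topologicalClosure_span hV hf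
  obtain ⟨-, a, b, -, -, hab⟩ := hF
  have hsum := (hab f hf).1
  set T := ∑' i, ‖inner ℂ (v i) f‖ ^ 2 with hT
  -- For finite combinations this is Cauchy–Schwarz plus the lower Riesz bound; it is a closed
  -- condition on `g`, so density allows `g = f`.
  have key : ∀ g ∈ closure (Submodule.span ℂ (Set.range v) : Set H),
      A * ‖inner ℂ g f‖ ^ 2 ≤ ‖g‖ ^ 2 * T := by
    intro g hg
    refine closure_minimal (t := {g | A * ‖inner ℂ g f‖ ^ 2 ≤ ‖g‖ ^ 2 * T}) ?_
      (isClosed_le (by fun_prop) (by fun_prop)) hg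
    intro g hg
    obtain ⟨c, rfl⟩ := (Finsupp.mem_span_range_iff_exists_finsupp).1 hg
    have hc := (hR c).1
    change A * ‖inner ℂ (∑ i ∈ c.support, c i • v i) f‖ ^ 2 ≤ ‖∑ i ∈ c.support, c i • v i‖ ^ 2 * T
    rw [sum_inner]
    have h1 : ‖∑ i ∈ c.support, inner ℂ (c i • v i) f‖ ^ 2
        ≤ (∑ i ∈ c.support, ‖c i‖ ^ 2) * T := by
      calc ‖∑ i ∈ c.support, inner ℂ (c i • v i) f‖ ^ 2
          ≤ (∑ i ∈ c.support, ‖c i‖ * ‖inner ℂ (v i) f‖) ^ 2 := by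
            gcongr
            refine (norm_sum_le _ _).trans_eq (Finset.sum_congr rfl fun i _ => ?_)
            rw [inner_smul_left, norm_mul, RCLike.norm_conj]
        _ ≤ (∑ i ∈ c.support, ‖c i‖ ^ 2) * ∑ i ∈ c.support, ‖inner ℂ (v i) f‖ ^ 2 :=
            Finset.sum_mul_sq_le_sq_mul_sq _ _ _
        _ ≤ _ := by
            gcongr
            exact hsum.sum_le_tsum _ fun i _ => by positivity
    have hT0 : 0 ≤ T := tsum_nonneg fun i => by positivity
    nlinarith [mul_le_mul_of_nonneg_left h1 hA.le, mul_le_mul_of_nonneg_right hc hT0]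
  have h1 := key f hcl
  rcases eq_or_ne f 0 with rfl | hne
  · simp [hT]
  · rw [inner_self_eq_norm_sq_to_K] at h1
    have h2 : 0 < ‖f‖ ^ 2 := by positivity
    have h3 : ‖((‖f‖ : ℂ)) ^ 2‖ = ‖f‖ ^ 2 := by simp
    erw [h3] at h1
    nlinarith

/-- A Paley–Wiener type theorem: a perturbation of a Riesz basis `v` of a closed subspace `V` by
members of `V`, such that the differences have an upper Riesz bound below the lower Riesz bound
of `v`, is a Riesz basis of `V`. -/
theorem IsRieszBasisWith.isRieszBasisOf_of_hasUpperRieszBound_sub [CompleteSpace H]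
    {V : Submodule ℂ H} (hV : IsClosed (V : Set H)) {v w : ι → H} {A B μ : ℝ}
    (h : IsRieszBasisWith V v A B) (hw : ∀ i, w i ∈ V) (hμ : 0 ≤ μ) (hμA : μ < A)
    (hvw : HasUpperRieszBound (fun i => v i - w i) μ) : IsRieszBasisOf V w := by
  have hA : 0 < A := h.1.1
  have hB : 0 < B := h.1.2.1
  have hvB := h.1.hasUpperRieszBound
  -- This weight gives `(1 + t) μ ≤ (A + μ) / 2 < A`; what is left, divided by the weight `1 + 1 /
  -- t` of the `w` term, is `δ`, which serves as both lower bounds.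
  set t := (A - μ) / (2 * A) with htdef
  have ht : 0 < t := div_pos (by linarith) (by linarith)
  have htμ : (1 + t) * μ < A := by
    have h1 : t * A = (A - μ) / 2 := by
      rw [htdef]
      field_simp
    nlinarith
  set δ := (A - (1 + t) * μ) / (1 + 1 / t) with hδdef
  have ht' : 0 < 1 + 1 / t := by positivity
  have hδ : 0 < δ := div_pos (by linarith) ht'
  have hδ' : (1 + 1 / t) * δ = A - (1 + t) * μ := by
    rw [hδdef]
    field_simp
  -- Here `w = v - (v - w)` is split with weight 1, hence the factors 2.
  have hwB : HasUpperRieszBound w (2 * B + 2 * μ) := by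
    intro s c
    have e : ∑ i ∈ s, c i • w i
        = ∑ i ∈ s, c i • v i + -∑ i ∈ s, c i • (v i - w i) := by
      rw [← sub_eq_add_neg, ← Finset.sum_sub_distrib]
      exact Finset.sum_congr rfl fun i _ => by rw [← smul_sub, sub_sub_cancel]
    have h1 := norm_add_sq_le_mul_sq_add_mul_sq one_pos (∑ i ∈ s, c i • v i)
      (-∑ i ∈ s, c i • (v i - w i))
    rw [← e, norm_neg] at h1
    linarith [hvB s c, hvw s c]
  refine ⟨δ, 2 * B + 2 * μ, ⟨hδ, by linarith, fun c => ⟨?_, hwB _ c⟩⟩, hw, δ, 2 * B + 2 * μ, hδ,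
    by linarith, fun f hf => ?_⟩
  · have e : ∑ i ∈ c.support, c i • v i
        = ∑ i ∈ c.support, c i • (v i - w i) + ∑ i ∈ c.support, c i • w i := by
      rw [← Finset.sum_add_distrib]
      exact Finset.sum_congr rfl fun i _ => by rw [← smul_add, sub_add_cancel]
    have h1 := norm_add_sq_le_mul_sq_add_mul_sq ht (∑ i ∈ c.support, c i • (v i - w i))
      (∑ i ∈ c.support, c i • w i)
    rw [← e] at h1
    have h2 := hvw c.support c
    have h3 := (h.1.2.2 c).1
    have h4 := mul_le_mul_of_nonneg_left h2 (by positivity : (0 : ℝ) ≤ 1 + t)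
    refine le_of_mul_le_mul_left ?_ ht'
    rw [← mul_assoc, hδ']
    linarith
  · have hbw := hwB.sum_norm_inner_sq_le (by linarith) f
    have hbd := hvw.sum_norm_inner_sq_le hμ f
    have hsw : Summable fun i => ‖inner ℂ (w i) f‖ ^ 2 :=
      summable_of_sum_le (fun i => by positivity) hbw
    have hsd : Summable fun i => ‖inner ℂ (v i - w i) f‖ ^ 2 :=
      summable_of_sum_le (fun i => by positivity) hbd
    refine ⟨hsw, ?_, hsw.tsum_le_of_sum_le hbw⟩
    have h1 : ∑' i, ‖inner ℂ (v i) f‖ ^ 2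
        ≤ (1 + t) * ∑' i, ‖inner ℂ (v i - w i) f‖ ^ 2
          + (1 + 1 / t) * ∑' i, ‖inner ℂ (w i) f‖ ^ 2 := by
      rw [← tsum_mul_left, ← tsum_mul_left,
        ← (hsd.mul_left _).tsum_add (hsw.mul_left _)]
      have hle : ∀ i, ‖inner ℂ (v i) f‖ ^ 2 ≤ (1 + t) * ‖inner ℂ (v i - w i) f‖ ^ 2
          + (1 + 1 / t) * ‖inner ℂ (w i) f‖ ^ 2 := fun i => by
        have := norm_add_sq_le_mul_sq_add_mul_sq ht (inner ℂ (v i - w i) f) (inner ℂ (w i) f)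
        rwa [← inner_add_left, sub_add_cancel] at this
      have hs := (hsd.mul_left (1 + t)).add (hsw.mul_left (1 + 1 / t))
      exact (Summable.of_nonneg_of_le (fun i => by positivity) hle hs).tsum_le_tsum hle hs
    have h2 := h.mul_norm_sq_le_tsum hV hf
    have h3 := mul_le_mul_of_nonneg_left (hsd.tsum_le_of_sum_le hbd)
      (by positivity : (0 : ℝ) ≤ 1 + t)
    refine le_of_mul_le_mul_left ?_ ht'
    rw [← mul_assoc, hδ']
    linarith

end PaleyWiener

/-! ### Integer translations on the Fourier side. -/

section FourierShift

theorem norm_fourier_apply (n : ℤ) (x : UnitAddCircle) : ‖fourier n x‖ = 1 := by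
  rw [fourier_apply, Circle.norm_coe]

theorem memLp_fourier_mul (n : ℤ) (f : L2R) :
    MemLp (fun ζ : ℝ => fourier n (ζ : UnitAddCircle) * f ζ) 2 := by
  refine (Lp.memLp f).of_le ?_ (.of_forall fun ζ => ?_)
  · exact (by fun_prop : Continuous fun ζ : ℝ =>
      fourier n (ζ : UnitAddCircle)).aestronglyMeasurable.mul (Lp.aestronglyMeasurable f)
  · rw [norm_mul, norm_fourier_apply, one_mul]

/-- Multiplication by the character `ζ ↦ exp (2πinζ)` on `L²(ℝ)`. -/
noncomputable def mulFourier (n : ℤ) (f : L2R) : L2R := (memLp_fourier_mul n f).toLp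

theorem coeFn_mulFourier (n : ℤ) (f : L2R) :
    mulFourier n f =ᵐ[volume] fun ζ : ℝ => fourier n (ζ : UnitAddCircle) * f ζ :=
  MemLp.coeFn_toLp _

theorem isometry_mulFourier (n : ℤ) : Isometry (mulFourier n) := by
  intro f g
  rw [edist_eq_enorm_sub, edist_eq_enorm_sub, Lp.enorm_def, Lp.enorm_def]
  refine eLpNorm_congr_norm_ae ?_
  filter_upwards [Lp.coeFn_sub f g, Lp.coeFn_sub (mulFourier n f) (mulFourier n g),
    coeFn_mulFourier n f, coeFn_mulFourier n g] with ζ h1 h2 h3 h4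
  rw [h1, h2, Pi.sub_apply, Pi.sub_apply, h3, h4, ← mul_sub, norm_mul, norm_fourier_apply, one_mul]

theorem SchwartzMap.fourier_compSubConstCLM_intCast (f : SchwartzMap ℝ ℂ) (k : ℤ) (ζ : ℝ) :
    𝓕 (f.compSubConstCLM ℂ (k : ℝ)) ζ = fourier (-k) (ζ : UnitAddCircle) * 𝓕 f ζ := by
  have := congrFun (Fourier.fourierIntegral_comp_add_right Real.fourierChar volume f (-(k : ℝ))) ζ
  rw [Circle.smul_def, Real.fourierChar_apply, smul_eq_mul] at this
  rw [SchwartzMap.fourier_coe, SchwartzMap.fourier_coe, Real.fourier_eq, fourier_coe_apply]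
  convert this using 1
  · simp [Fourier.fourierIntegral, VectorFourier.fourierIntegral, sub_eq_add_neg, mul_comm]
  · congr 1
    · congr 1
      push_cast
      ring
    · simp [Real.fourier_eq, Fourier.fourierIntegral, VectorFourier.fourierIntegral, mul_comm]

theorem shiftBy_toLp (f : SchwartzMap ℝ ℂ) (k : ℤ) :
    shiftBy k (f.toLp 2) = (f.compSubConstCLM ℂ (k : ℝ)).toLp 2 := rfl

theorem isometry_shiftBy (k : ℤ) : Isometry (shiftBy k) :=
  Lp.isometry_compMeasurePreserving _

/-- The Fourier transform turns integer translations into multiplications by characters. -/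
theorem fourier_shiftBy (k : ℤ) (f : L2R) : 𝓕 (shiftBy k f) = mulFourier (-k) (𝓕 f) := by
  -- Both sides are continuous in `f`, so Schwartz functions suffice, where the integral formula is
  -- available.
  refine DenseRange.induction_on
    (SchwartzMap.denseRange_toLpCLM (E := ℝ) (F := ℂ) (μ := volume) (p := 2)
      ENNReal.ofNat_ne_top) f
    (isClosed_eq ?_ ?_) fun s => ?_
  · exact (Lp.fourierTransformₗᵢ ℝ ℂ).continuous.comp (isometry_shiftBy k).continuous
  · exact (isometry_mulFourier _).continuous.comp (Lp.fourierTransformₗᵢ ℝ ℂ).continuous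
  · rw [SchwartzMap.toLpCLM_apply, shiftBy_toLp, SchwartzMap.toLp_fourier_eq,
      SchwartzMap.toLp_fourier_eq]
    refine Lp.ext ?_
    filter_upwards [SchwartzMap.coeFn_toLp (𝓕 (s.compSubConstCLM ℂ (k : ℝ))) 2 volume,
      coeFn_mulFourier (-k) ((𝓕 s).toLp 2), SchwartzMap.coeFn_toLp (𝓕 s) 2 volume]
      with ζ h1 h2 h3
    rw [h1, h2, h3, SchwartzMap.fourier_compSubConstCLM_intCast]

theorem fourier_sum_smul_shiftBy (s : Finset ℤ) (c : ℤ → ℂ) (g : L2R) :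
    (𝓕 (∑ k ∈ s, c k • shiftBy k g) : L2R) =ᵐ[volume]
      fun ζ : ℝ => (∑ k ∈ s, c k * fourier (-k) (ζ : UnitAddCircle)) * (𝓕 g : L2R) ζ := by
  classical
  induction s using Finset.induction_on with
  | empty =>
    have h : (𝓕 (0 : L2R) : L2R) = 0 := (Lp.fourierTransformₗᵢ ℝ ℂ).map_zero
    rw [Finset.sum_empty, h]
    filter_upwards [Lp.coeFn_zero ℂ 2 (volume : Measure ℝ)] with ζ hζ
    rw [hζ, Finset.sum_empty, zero_mul, Pi.zero_apply]
  | insert a s ha ih =>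
    rw [Finset.sum_insert ha, FourierTransform.fourier_add, FourierTransform.fourier_smul,
      fourier_shiftBy]
    filter_upwards [ih, coeFn_mulFourier (-a) (𝓕 g), Lp.coeFn_smul (c a) (mulFourier (-a) (𝓕 g)),
      Lp.coeFn_add (c a • mulFourier (-a) (𝓕 g)) (𝓕 (∑ k ∈ s, c k • shiftBy k g))]
      with ζ h1 h2 h3 h4
    rw [h4, Pi.add_apply, h1, h3, Pi.smul_apply, h2, Finset.sum_insert ha, smul_eq_mul]
    ring

end FourierShift

/-! ### Parseval's identity and periodization. -/

section Periodization

theorem Lp.enorm_sq_eq_lintegral {α E : Type*} [MeasurableSpace α] {ν : Measure α}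
    [NormedAddCommGroup E] (f : Lp E 2 ν) : ‖f‖ₑ ^ 2 = ∫⁻ x, ‖f x‖ₑ ^ 2 ∂ν := by
  have := eLpNorm_nnreal_pow_eq_lintegral (f := f) (μ := ν) (p := 2) two_ne_zero
  rw [Lp.enorm_def]
  simpa using this

/-- Parseval's identity for trigonometric polynomials. -/
theorem lintegral_enorm_sum_fourier_sq (s : Finset ℤ) (c : ℤ → ℂ) (a : ℝ) :
    ∫⁻ ζ in Set.Ico a (a + 1), ‖∑ k ∈ s, c k * fourier (-k) (ζ : UnitAddCircle)‖ₑ ^ 2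
      = ENNReal.ofReal (∑ k ∈ s, ‖c k‖ ^ 2) := by
  rw [restrict_Ico_eq_restrict_Ioc, AddCircle.lintegral_preimage 1 a
    (fun x => ‖∑ k ∈ s, c k * fourier (-k) x‖ₑ ^ 2), AddCircle.volume_eq_smul_haarAddCircle,
    ENNReal.ofReal_one, one_smul]
  have horth : Orthonormal ℂ fun k : ℤ => fourierLp (T := 1) 2 (-k) :=
    orthonormal_fourier.comp _ neg_injective
  have h1 : ‖∑ k ∈ s, c k • fourierLp (T := 1) 2 (-k)‖ ^ 2 = ∑ k ∈ s, ‖c k‖ ^ 2 := by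
    have h := horth.inner_sum c c s
    rw [inner_self_eq_norm_sq_to_K] at h
    simp_rw [Complex.conj_mul'] at h
    refine Complex.ofReal_injective ?_
    push_cast
    exact h
  rw [← h1, ENNReal.ofReal_pow (norm_nonneg _), ofReal_norm, Lp.enorm_sq_eq_lintegral]
  refine lintegral_congr_ae ?_
  have h2 : ∀ᵐ x ∂(AddCircle.haarAddCircle : Measure UnitAddCircle), ∀ k : ℤ,
      fourierLp (T := 1) 2 (-k) x = fourier (-k) x :=
    ae_all_iff.2 fun k => coeFn_fourierLp 2 (-k)
  have h3 : ∀ᵐ x ∂(AddCircle.haarAddCircle : Measure UnitAddCircle), ∀ k : ℤ,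
      (c k • fourierLp (T := 1) 2 (-k)) x = c k • fourierLp (T := 1) 2 (-k) x :=
    ae_all_iff.2 fun k => Lp.coeFn_smul _ _
  filter_upwards [h2, h3, Lp.coeFn_finsetSum s fun k => c k • fourierLp (T := 1) 2 (-k)]
    with x h2 h3 h4
  rw [h4, Finset.sum_apply]
  simp only [h2, h3, smul_eq_mul]

/-- The integer translates of `[a, a + 1)` tile the line, and Tonelli exchanges sum and integral. -/
theorem lintegral_eq_lintegral_Ico_tsum (a : ℝ) {F : ℝ → ℝ≥0∞} (hF : AEMeasurable F) :
    ∫⁻ x, F x = ∫⁻ x in Set.Ico a (a + 1), ∑' n : ℤ, F (x + n) := by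
  have hmp (n : ℤ) := measurePreserving_add_right volume (n : ℝ)
  have hm (n : ℤ) : AEMeasurable (fun x => F (x + n)) (volume.restrict (Set.Ico a (a + 1))) :=
    (hF.comp_quasiMeasurePreserving (hmp n).quasiMeasurePreserving).restrict
  rw [lintegral_tsum hm,
    ← setLIntegral_univ, ← iUnion_Ico_add_intCast a,
    lintegral_iUnion (fun n => measurableSet_Ico) (Set.pairwise_disjoint_Ico_add_intCast a)]
  refine tsum_congr fun n => ?_
  rw [← (hmp n).setLIntegral_comp_preimage_emb (measurableEmbedding_addRight _) F,
    Set.preimage_add_const_Ico]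
  congr 3 <;> ring

/-- If the periodization of `|𝓕 g|²` is bounded by `μ`, then `μ` is an upper Riesz bound for the
integer translates of `g`. -/
theorem norm_sum_smul_shiftBy_sq_le {g : L2R} {μ : ℝ≥0} {a : ℝ}
    (h : ∀ᵐ ζ : ℝ ∂(volume.restrict (Set.Ico a (a + 1))),
      ∑' k : ℤ, ‖(𝓕 g : L2R) (ζ + (k : ℝ))‖ₑ ^ 2 ≤ (μ : ℝ≥0∞))
    (s : Finset ℤ) (c : ℤ → ℂ) :
    ‖∑ k ∈ s, c k • shiftBy k g‖ ^ 2 ≤ μ * ∑ k ∈ s, ‖c k‖ ^ 2 := by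
  have hP : Continuous fun ζ : ℝ => ∑ k ∈ s, c k * fourier (-k) (ζ : UnitAddCircle) := by
    fun_prop
  have key : ‖∑ k ∈ s, c k • shiftBy k g‖ₑ ^ 2
      ≤ ENNReal.ofReal (μ * ∑ k ∈ s, ‖c k‖ ^ 2) := by
    calc ‖∑ k ∈ s, c k • shiftBy k g‖ₑ ^ 2
        = ‖(𝓕 (∑ k ∈ s, c k • shiftBy k g) : L2R)‖ₑ ^ 2 := by
          rw [← ofReal_norm, ← ofReal_norm, Lp.norm_fourier_eq]
      _ = ∫⁻ ζ : ℝ, ‖∑ k ∈ s, c k * fourier (-k) (ζ : UnitAddCircle)‖ₑ ^ 2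
            * ‖(𝓕 g : L2R) ζ‖ₑ ^ 2 := by
          rw [Lp.enorm_sq_eq_lintegral]
          refine lintegral_congr_ae ?_
          filter_upwards [fourier_sum_smul_shiftBy s c g] with ζ hζ
          rw [hζ, enorm_mul, mul_pow]
      _ = ∫⁻ ζ in Set.Ico a (a + 1), ‖∑ k ∈ s, c k * fourier (-k) (ζ : UnitAddCircle)‖ₑ ^ 2
            * ∑' n : ℤ, ‖(𝓕 g : L2R) (ζ + n)‖ₑ ^ 2 := by
          refine (lintegral_eq_lintegral_Ico_tsum a
            ((hP.measurable.enorm.pow_const 2).aemeasurable.mul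
              ((Lp.aestronglyMeasurable _).enorm.pow_const 2))).trans ?_
          refine lintegral_congr fun ζ => ?_
          rw [← ENNReal.tsum_mul_left]
          refine tsum_congr fun n => ?_
          simp only [Pi.mul_apply]
          -- Periodicity lets the trigonometric polynomial leave the sum over `n`.
          have hn : ((ζ + n : ℝ) : UnitAddCircle) = ζ := by
            have h2 : ((n : ℝ) : UnitAddCircle) = 0 :=
              (AddCircle.coe_eq_zero_iff 1).2 ⟨n, by simp⟩
            rw [AddCircle.coe_add, h2, add_zero]
          rw [hn]
      _ ≤ ∫⁻ ζ in Set.Ico a (a + 1), ‖∑ k ∈ s, c k * fourier (-k) (ζ : UnitAddCircle)‖ₑ ^ 2 * μ := by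
          refine lintegral_mono_ae ?_
          filter_upwards [h] with ζ hζ
          gcongr
      _ = _ := by
          rw [lintegral_mul_const _ (hP.measurable.enorm.pow_const 2),
            lintegral_enorm_sum_fourier_sq, mul_comm, ENNReal.ofReal_mul μ.coe_nonneg,
            ENNReal.ofReal_coe_nnreal]
  rw [← ofReal_norm, ← ENNReal.ofReal_pow (norm_nonneg _)] at key
  exact (ENNReal.ofReal_le_ofReal_iff (by positivity)).1 key

end Periodization

/-! ### Application to the generators and their weavings. -/

theorem shiftBy_sub (k : ℤ) (f g : L2R) : shiftBy k (f - g) = shiftBy k f - shiftBy k g :=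
  map_sub (Lp.compMeasurePreserving _ _) f g

/-- The a.e. identity is needed at all points `ζ + k` at once; translations preserve null sets and
`ℤ` is countable. -/
theorem ae_tsum_fourier_sub_le {φ ψ : L2R} {μ : ℝ≥0} {S : Set ℝ}
    (h : ∀ᵐ ζ : ℝ ∂(volume.restrict S),
      ∑' k : ℤ, ‖(𝓕 φ : L2R) (ζ + (k : ℝ)) - (𝓕 ψ : L2R) (ζ + (k : ℝ))‖ₑ ^ 2 ≤ (μ : ℝ≥0∞)) :
    ∀ᵐ ζ : ℝ ∂(volume.restrict S),
      ∑' k : ℤ, ‖(𝓕 (φ - ψ) : L2R) (ζ + (k : ℝ))‖ₑ ^ 2 ≤ (μ : ℝ≥0∞) := by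
  have hsub : (𝓕 (φ - ψ) : L2R) = 𝓕 φ - 𝓕 ψ := (Lp.fourierTransformₗᵢ ℝ ℂ).map_sub φ ψ
  have hall : ∀ᵐ ζ : ℝ, ∀ k : ℤ, (𝓕 (φ - ψ) : L2R) (ζ + (k : ℝ))
      = (𝓕 φ : L2R) (ζ + (k : ℝ)) - (𝓕 ψ : L2R) (ζ + (k : ℝ)) := by
    rw [hsub]
    exact ae_all_iff.2 fun k =>
      (measurePreserving_add_right volume (k : ℝ)).quasiMeasurePreserving.ae
        (Lp.coeFn_sub (𝓕 φ) (𝓕 ψ))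
  filter_upwards [h, ae_restrict_of_ae hall] with ζ h1 h2
  simpa only [h2] using h1

theorem mainTheorem3
    (V : Submodule ℂ L2R) (hV : IsShiftInvariantSpace V)
    (φ : L2R) (A B : ℝ) (hφ : IsRieszGeneratorWith V φ A B)
    (ψ : L2R) (hψ : ψ ∈ V)
    (μ : ℝ≥0) (hμA : (μ : ℝ) < A)
    (hclose : ∀ᵐ ζ : ℝ ∂(volume.restrict (Set.Ico (-1 / 2 : ℝ) (1 / 2))),
      ∑' k : ℤ, ‖(𝓕 φ : L2R) (ζ + (k : ℝ)) - (𝓕 ψ : L2R) (ζ + (k : ℝ))‖ₑ ^ 2 ≤ (μ : ℝ≥0∞)) :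
    IsRieszBasisOf V (fun k : ℤ => shiftBy k ψ) ∧
      AreWovenIn V (fun k : ℤ => shiftBy k φ) (fun k : ℤ => shiftBy k ψ) := by
  classical
  have hbound : HasUpperRieszBound (fun k : ℤ => shiftBy k φ - shiftBy k ψ) (μ : ℝ) := by
    intro s c
    have hI : (1 / 2 : ℝ) = -1 / 2 + 1 := by norm_num
    rw [hI] at hclose
    simpa only [shiftBy_sub] using
      norm_sum_smul_shiftBy_sq_le (ae_tsum_fourier_sub_le hclose) s c
  have hψV (k : ℤ) : shiftBy k ψ ∈ V := hV.shiftBy_mem k ψ hψ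
  refine ⟨IsRieszBasisWith.isRieszBasisOf_of_hasUpperRieszBound_sub hV.isClosed hφ hψV
    μ.coe_nonneg hμA hbound, fun J => ?_⟩
  have hJ : IsRieszBasisOf V (weaving (fun k : ℤ => shiftBy k φ) (fun k => shiftBy k ψ) J) := by
    refine IsRieszBasisWith.isRieszBasisOf_of_hasUpperRieszBound_sub hV.isClosed hφ
      (fun k => ?_) μ.coe_nonneg hμA fun s c => ?_
    · unfold weaving
      split_ifs
      exacts [hφ.2.1 k, hψV k]
    -- On `J` the difference is zero, which amounts to dropping the coefficients there; this can
    -- only decrease `∑ ‖c k‖²`.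
    · have hterm : ∀ k, c k • (shiftBy k φ
          - weaving (fun k : ℤ => shiftBy k φ) (fun k => shiftBy k ψ) J k)
          = (if k ∈ J then 0 else c k) • (shiftBy k φ - shiftBy k ψ) := fun k => by
        by_cases hk : k ∈ J <;> simp [weaving, hk]
      simp only [hterm]
      refine (hbound s fun k => if k ∈ J then 0 else c k).trans ?_
      gcongr with k
      split_ifs <;> simp
  obtain ⟨A', B', h⟩ := hJ
  exact h.2
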